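/- Let $\mathcal P$ be a partition of $[n]=\{1,\dots,n\}$ and let $\mathcal U$ be a subspace of $\mathbb R^n$. An $n\times n$ real matrix is called $\mathcal P$-block-diagonal if it is zero except for the principal submatrices indexed by the elements of $\mathcal P$. Given an $n\times n$ matrix $X$, block minimum trace factor analysis (BMTFA) is the problem of minimizing $\operatorname{tr}(L)$ over pairs $(B,L)$ with $X=B+L$, $L\succeq 0$ and $B$ $\mathcal P$-block-diagonal. For $\mathcal I\subseteq[n]$ let $S^{\mathcal I}=\{x\in\mathbb R^n:\|x\|_2=1,\ x_j=0\text{ for } j\notin\mathcal I\}$. A (possibly degenerate) centered ellipsoid in $\mathbb R^k$ is a set of the form $\{x\in\mathbb R^k: x^TMx\le 1\}$ with $M$ a symmetric positive semidefinite $k\times k$ matrix. Then the following are equivalent: 1. $\mathcal U$ is recoverable by BMTFA: for every $\mathcal P$-block-diagonal $B^\star$ and every positive semidefinite $L^\star$ with column space $\mathcal U$, the pair $(B^\star,L^\star)$ is the unique optimum of BMTFA with input $X=B^\star+L^\star$. 2. $\mathcal U$ is $\mathcal P$-realizable: there is a positive semidefinite $n\times n$ matrix $Y$, all of whose principal submatrices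 indexed by the elements of $\mathcal P$ are identity matrices, whose nullspace contains $\mathcal U$. 3. $\mathcal U^\perp$ has the $\mathcal P$-ellipsoid fitting property: there are a $k$ and a $k\times n$ matrix $V$ with row space $\mathcal U^\perp$ such that some centered ellipsoid in $\mathbb R^k$ has boundary containing $\bigcup_{\mathcal I\in\mathcal P}V(S^{\mathcal I})$. -/

import Mathlib

open scoped Matrix

/-- The column space of `A`, that is, the range of `A` as a linear map between Euclidean spaces. -/
noncomputable def columnSpace {m n : ℕ} (A : Matrix (Fin m) (Fin n) ℝ) :
    Submodule ℝ (EuclideanSpace ℝ (Fin m)) :=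
  LinearMap.range (Matrix.toEuclideanLin A)

/-- The row space of `A`, that is, the column space of its transpose. -/
noncomputable def rowSpace {m n : ℕ} (A : Matrix (Fin m) (Fin n) ℝ) :
    Submodule ℝ (EuclideanSpace ℝ (Fin n)) :=
  columnSpace Aᵀ

/-- The nullspace of `A`. -/
noncomputable def nullSpace {m n : ℕ} (A : Matrix (Fin m) (Fin n) ℝ) :
    Submodule ℝ (EuclideanSpace ℝ (Fin n)) :=
  LinearMap.ker (Matrix.toEuclideanLin A)

/-- `B` is `P`-block-diagonal: it vanishes outside the principal submatrices indexed by the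
elements of the partition `P`. -/
def IsBlockDiagonal {n : ℕ} (P : Finpartition (Finset.univ : Finset (Fin n)))
    (B : Matrix (Fin n) (Fin n) ℝ) : Prop :=
  ∀ i j : Fin n, (¬ ∃ I ∈ P.parts, i ∈ I ∧ j ∈ I) → B i j = 0

/-- `(B, L)` is feasible for block minimum trace factor analysis with input `X`. -/
structure BMTFAFeasible {n : ℕ} (P : Finpartition (Finset.univ : Finset (Fin n)))
    (X B L : Matrix (Fin n) (Fin n) ℝ) : Prop where
  decomp : X = B + L
  posSemidef : L.PosSemidef
  blockDiagonal : IsBlockDiagonal P B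

/-- `(B, L)` minimizes the trace of the second component among all feasible pairs. -/
def BMTFAOptimal {n : ℕ} (P : Finpartition (Finset.univ : Finset (Fin n)))
    (X B L : Matrix (Fin n) (Fin n) ℝ) : Prop :=
  BMTFAFeasible P X B L ∧
    ∀ B' L' : Matrix (Fin n) (Fin n) ℝ, BMTFAFeasible P X B' L' → L.trace ≤ L'.trace

/-- `(B, L)` is the unique optimum of block minimum trace factor analysis with input `X`. -/
def BMTFAUniqueOptimum {n : ℕ} (P : Finpartition (Finset.univ : Finset (Fin n)))
    (X B L : Matrix (Fin n) (Fin n) ℝ) : Prop :=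
  BMTFAOptimal P X B L ∧
    ∀ B' L' : Matrix (Fin n) (Fin n) ℝ, BMTFAOptimal P X B' L' → B' = B ∧ L' = L

/-- `U` is recoverable by block minimum trace factor analysis. -/
def RecoverableByBMTFA {n : ℕ} (P : Finpartition (Finset.univ : Finset (Fin n)))
    (U : Submodule ℝ (EuclideanSpace ℝ (Fin n))) : Prop :=
  ∀ B L : Matrix (Fin n) (Fin n) ℝ, IsBlockDiagonal P B → L.PosSemidef → columnSpace L = U →
    BMTFAUniqueOptimum P (B + L) B L

/-- The `P`-elliptope: positive semidefinite matrices all of whose principal submatrices indexed by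
elements of `P` are identity matrices. -/
def blockElliptope {n : ℕ} (P : Finpartition (Finset.univ : Finset (Fin n))) :
    Set (Matrix (Fin n) (Fin n) ℝ) :=
  {Y | Y.PosSemidef ∧ ∀ I ∈ P.parts,
    Y.submatrix (Subtype.val : {i // i ∈ I} → Fin n) (Subtype.val : {i // i ∈ I} → Fin n) = 1}

/-- `U` is `P`-realizable. -/
def BlockRealizable {n : ℕ} (P : Finpartition (Finset.univ : Finset (Fin n)))
    (U : Submodule ℝ (EuclideanSpace ℝ (Fin n))) : Prop :=
  ∃ Y ∈ blockElliptope P, U ≤ nullSpace Y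

/-- The unit sphere of the coordinate subspace indexed by `I`. -/
def blockSphere {n : ℕ} (I : Finset (Fin n)) : Set (EuclideanSpace ℝ (Fin n)) :=
  {x | ‖x‖ = 1 ∧ ∀ j, j ∉ I → x j = 0}

/-- A (possibly degenerate) centered ellipsoid in `ℝ^k`: a set `{x | xᵀ M x ≤ 1}` with `M` positive
semidefinite. -/
def IsCenteredEllipsoid {k : ℕ} (E : Set (EuclideanSpace ℝ (Fin k))) : Prop :=
  ∃ M : Matrix (Fin k) (Fin k) ℝ, M.PosSemidef ∧
    E = {x | inner ℝ x (Matrix.toEuclideanLin M x) ≤ 1}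

/-- `W` has the `P`-ellipsoid fitting property. -/
def BlockEllipsoidFitting {n : ℕ} (P : Finpartition (Finset.univ : Finset (Fin n)))
    (W : Submodule ℝ (EuclideanSpace ℝ (Fin n))) : Prop :=
  ∃ (k : ℕ) (V : Matrix (Fin k) (Fin n) ℝ), rowSpace V = W ∧
    ∃ E : Set (EuclideanSpace ℝ (Fin k)), IsCenteredEllipsoid E ∧
      (⋃ I ∈ P.parts, Matrix.toEuclideanLin V '' blockSphere I) ⊆ frontier E

/-! A matrix `Y` in the elliptope that annihilates `U` is a dual certificate. Its diagonal blocks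
are identities, so pairing it with a block-diagonal `D` returns `D.trace`. Hence a feasible `L'`
exceeds `L` in trace by `(Y * L').trace ≥ 0`. Equality forces `Y * L' = 0`, so `Y` kills the
block-diagonal matrix `L' - L`, which must then vanish.

Conversely, test recoverability on the projection onto `U` alone. If no certificate exists,
Hahn–Banach separation (`exists_mem_blockElliptope_or_certificate`) gives a block-diagonal direction
that lowers the trace and stays feasible. Separating from the image of the trace-one slice, which is
compact, avoids asking whether the image of the whole cone is closed.

Ellipsoids are certificates in other coordinates: `M` in `ℝ^k` pulls back to `Y = Vᵀ * M * V`, and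
the quadratic form of `Y` equals 1 on every block sphere exactly when the diagonal blocks are
identities. -/

namespace Matrix

theorem PosSemidef.exists_eq_transpose_mul_self {n : ℕ} {A : Matrix (Fin n) (Fin n) ℝ}
    (hA : A.PosSemidef) : ∃ C : Matrix (Fin n) (Fin n) ℝ, A = Cᵀ * C := by
  open scoped MatrixOrder in
  obtain ⟨C, hC⟩ := CStarAlgebra.nonneg_iff_eq_star_mul_self.mp hA.nonneg
  exact ⟨C, by simpa [star_eq_conjTranspose] using hC⟩

theorem PosSemidef.trace_mul_nonneg {n : ℕ} {A B : Matrix (Fin n) (Fin n) ℝ}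
    (hA : A.PosSemidef) (hB : B.PosSemidef) : 0 ≤ (A * B).trace := by
  obtain ⟨C, rfl⟩ := hA.exists_eq_transpose_mul_self
  have h := (hB.mul_mul_conjTranspose_same C).trace_nonneg
  rwa [conjTranspose_eq_transpose_of_trivial, Matrix.trace_mul_comm, ← Matrix.mul_assoc] at h

/-- With `A = Cᵀ * C` and `B = Eᵀ * E`, the trace is the squared Frobenius norm of `C * Eᵀ`. -/
theorem PosSemidef.mul_eq_zero_of_trace_mul_eq_zero {n : ℕ} {A B : Matrix (Fin n) (Fin n) ℝ}
    (hA : A.PosSemidef) (hB : B.PosSemidef) (h : (A * B).trace = 0) : A * B = 0 := by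
  obtain ⟨C, rfl⟩ := hA.exists_eq_transpose_mul_self
  obtain ⟨E, rfl⟩ := hB.exists_eq_transpose_mul_self
  have key : C * Eᵀ = 0 := by
    rw [← trace_conjTranspose_mul_self_eq_zero_iff, ← h]
    simp only [conjTranspose_eq_transpose_of_trivial, transpose_mul, transpose_transpose]
    rw [Matrix.trace_mul_comm (Cᵀ * C), Matrix.trace_mul_comm (E * Cᵀ)]
    rw [Matrix.mul_assoc, Matrix.trace_mul_comm C]
    simp only [Matrix.mul_assoc]
  calc Cᵀ * C * (Eᵀ * E) = Cᵀ * (C * Eᵀ) * E := by simp only [Matrix.mul_assoc]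
    _ = 0 := by simp [key]

end Matrix

/-! ### Column spaces, projections and quadratic forms -/

theorem mul_eq_zero_iff_columnSpace_le_nullSpace {n : ℕ} (Y L : Matrix (Fin n) (Fin n) ℝ) :
    Y * L = 0 ↔ columnSpace L ≤ nullSpace Y := by
  rw [columnSpace, nullSpace, LinearMap.range_le_ker_iff, ← Matrix.toLpLin_mul_same,
    LinearEquiv.map_eq_zero_iff]

theorem inner_toEuclideanLin {k : ℕ} (M : Matrix (Fin k) (Fin k) ℝ)
    (x : EuclideanSpace ℝ (Fin k)) :
    inner ℝ x (Matrix.toEuclideanLin M x) = x.ofLp ⬝ᵥ (M *ᵥ x.ofLp) := by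
  simp [EuclideanSpace.inner_eq_star_dotProduct, dotProduct_comm]

/-- The quadratic form of a congruent matrix. -/
theorem inner_toEuclideanLin_congruence {k n : ℕ} (M : Matrix (Fin k) (Fin k) ℝ)
    (V : Matrix (Fin k) (Fin n) ℝ) (x : EuclideanSpace ℝ (Fin n)) :
    inner ℝ (Matrix.toEuclideanLin V x) (Matrix.toEuclideanLin M (Matrix.toEuclideanLin V x)) =
      inner ℝ x (Matrix.toEuclideanLin (Vᵀ * M * V) x) := by
  rw [inner_toEuclideanLin, inner_toEuclideanLin]
  simp only [Matrix.ofLp_toLpLin, Matrix.toLin'_apply, ← Matrix.mulVec_mulVec]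
  rw [Matrix.dotProduct_mulVec _ Vᵀ, Matrix.vecMul_transpose]

theorem nullSpace_eq_rowSpace_orthogonal {k n : ℕ} (V : Matrix (Fin k) (Fin n) ℝ) :
    nullSpace V = (rowSpace V)ᗮ := by
  have h := Matrix.toEuclideanLin_conjTranspose_eq_adjoint V
  rw [Matrix.conjTranspose_eq_transpose_of_trivial] at h
  rw [rowSpace, columnSpace, h, LinearMap.orthogonal_range, LinearMap.adjoint_adjoint, nullSpace]

/-- The matrix of the orthogonal projection onto a subspace. -/
noncomputable def projectionMatrix {n : ℕ} (W : Submodule ℝ (EuclideanSpace ℝ (Fin n))) :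
    Matrix (Fin n) (Fin n) ℝ :=
  Matrix.toEuclideanLin.symm W.starProjection.toLinearMap

theorem toEuclideanLin_projectionMatrix {n : ℕ} (W : Submodule ℝ (EuclideanSpace ℝ (Fin n))) :
    Matrix.toEuclideanLin (projectionMatrix W) = W.starProjection.toLinearMap := by
  simp [projectionMatrix]

theorem columnSpace_projectionMatrix {n : ℕ} (W : Submodule ℝ (EuclideanSpace ℝ (Fin n))) :
    columnSpace (projectionMatrix W) = W := by
  rw [columnSpace, toEuclideanLin_projectionMatrix]
  exact Submodule.range_starProjection W

theorem projectionMatrix_posSemidef {n : ℕ} (W : Submodule ℝ (EuclideanSpace ℝ (Fin n))) :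
    (projectionMatrix W).PosSemidef := by
  rw [← Matrix.isPositive_toEuclideanLin_iff, toEuclideanLin_projectionMatrix]
  exact (Submodule.isSymmetricProjection_starProjection W).isPositive

theorem projectionMatrix_transpose {n : ℕ} (W : Submodule ℝ (EuclideanSpace ℝ (Fin n))) :
    (projectionMatrix W)ᵀ = projectionMatrix W := by
  have h := (projectionMatrix_posSemidef W).isHermitian
  rwa [Matrix.IsHermitian, Matrix.conjTranspose_eq_transpose_of_trivial] at h

theorem rowSpace_projectionMatrix {n : ℕ} (W : Submodule ℝ (EuclideanSpace ℝ (Fin n))) :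
    rowSpace (projectionMatrix W) = W := by
  rw [rowSpace, projectionMatrix_transpose, columnSpace_projectionMatrix]

/-- The boundary of a centered ellipsoid. -/
theorem frontier_centeredEllipsoid {k : ℕ} (M : Matrix (Fin k) (Fin k) ℝ) :
    frontier {x : EuclideanSpace ℝ (Fin k) | inner ℝ x (Matrix.toEuclideanLin M x) ≤ 1} =
      {x | inner ℝ x (Matrix.toEuclideanLin M x) = 1} := by
  have hcont : Continuous fun x : EuclideanSpace ℝ (Fin k) =>
      inner ℝ x (Matrix.toEuclideanLin M x) :=
    continuous_id.inner (LinearMap.continuous_of_finiteDimensional _)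
  apply subset_antisymm (frontier_le_subset_eq hcont continuous_const)
  intro x hx
  simp only [Set.mem_ofPred_eq] at hx
  rw [frontier_eq_closure_inter_closure]
  refine ⟨subset_closure hx.le, ?_⟩
  -- The points `t • x` with `t > 1` lie outside the ellipsoid, since the form scales by `t ^ 2`,
  -- and they converge to `x`.
  have hlim : Filter.Tendsto (fun t : ℝ => t • x) (nhdsWithin 1 (Set.Ioi 1)) (nhds x) := by
    have h : Filter.Tendsto (fun t : ℝ => t • x) (nhds 1) (nhds ((1 : ℝ) • x)) :=
      (continuous_id.smul continuous_const).tendsto 1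
    rw [one_smul] at h
    exact h.mono_left nhdsWithin_le_nhds
  refine mem_closure_of_tendsto hlim ?_
  filter_upwards [self_mem_nhdsWithin] with t ht
  simp only [Set.mem_compl_iff, Set.mem_ofPred_eq, not_le, map_smul, inner_smul_left,
    inner_smul_right, hx]
  have : (1 : ℝ) < t := ht
  simp
  nlinarith

/-! ### Block-diagonal matrices and the elliptope -/

section Blocks

variable {n : ℕ} (P : Finpartition (Finset.univ : Finset (Fin n)))

theorem exists_part_mem_self (i : Fin n) : ∃ I ∈ P.parts, i ∈ I ∧ i ∈ I :=
  ⟨P.part i, P.part_mem.2 (Finset.mem_univ i), by simp⟩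

theorem mem_blockElliptope_iff (Y : Matrix (Fin n) (Fin n) ℝ) :
    Y ∈ blockElliptope P ↔ Y.PosSemidef ∧
      ∀ i j, (∃ I ∈ P.parts, i ∈ I ∧ j ∈ I) → Y i j = (1 : Matrix (Fin n) (Fin n) ℝ) i j := by
  refine and_congr_right fun _ => ⟨?_, ?_⟩
  · rintro h i j ⟨I, hI, hi, hj⟩
    simpa [Matrix.one_apply] using congrFun (congrFun (h I hI) ⟨i, hi⟩) ⟨j, hj⟩
  · intro h I hI
    ext ⟨i, hi⟩ ⟨j, hj⟩
    simpa [Matrix.one_apply] using h i j ⟨I, hI, hi, hj⟩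

variable {P}

theorem IsBlockDiagonal.trace_mul {Y D : Matrix (Fin n) (Fin n) ℝ} (hD : IsBlockDiagonal P D)
    (hY : Y ∈ blockElliptope P) : (Y * D).trace = D.trace := by
  rw [mem_blockElliptope_iff] at hY
  conv_rhs => rw [← Matrix.one_mul D]
  simp only [Matrix.trace, Matrix.diag, Matrix.mul_apply]
  refine Finset.sum_congr rfl fun i _ => Finset.sum_congr rfl fun j _ => ?_
  by_cases h : ∃ I ∈ P.parts, i ∈ I ∧ j ∈ I
  · rw [hY.2 i j h]
  · rw [hD j i (by simpa only [and_comm] using h), mul_zero, mul_zero]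

/-- The diagonal blocks of `Y * D` are those of `D`, so `Y * D = 0` forces `D = 0`. -/
theorem IsBlockDiagonal.eq_zero_of_mul_eq_zero {Y D : Matrix (Fin n) (Fin n) ℝ}
    (hD : IsBlockDiagonal P D) (hY : Y ∈ blockElliptope P) (h : Y * D = 0) : D = 0 := by
  rw [mem_blockElliptope_iff] at hY
  ext i j
  by_cases hij : ∃ I ∈ P.parts, i ∈ I ∧ j ∈ I
  · rw [← h, ← Matrix.one_mul D, Matrix.mul_apply, Matrix.one_mul, Matrix.mul_apply]
    refine Finset.sum_congr rfl fun l _ => ?_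
    by_cases hil : ∃ I ∈ P.parts, i ∈ I ∧ l ∈ I
    · rw [hY.2 i l hil]
    · rw [hD l j, mul_zero, mul_zero]
      rintro ⟨J, hJ, hl, hj⟩
      obtain ⟨I, hI, hi, hj'⟩ := hij
      obtain rfl := P.eq_of_mem_parts hI hJ hj' hj
      exact hil ⟨I, hI, hi, hl⟩
  · exact hD i j hij

theorem IsBlockDiagonal.sub {A B : Matrix (Fin n) (Fin n) ℝ} (hA : IsBlockDiagonal P A)
    (hB : IsBlockDiagonal P B) : IsBlockDiagonal P (A - B) := fun i j h => by
  rw [Matrix.sub_apply, hA i j h, hB i j h, sub_zero]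

theorem IsBlockDiagonal.smul {A : Matrix (Fin n) (Fin n) ℝ} (hA : IsBlockDiagonal P A) (c : ℝ) :
    IsBlockDiagonal P (c • A) := fun i j h => by
  rw [Matrix.smul_apply, hA i j h, smul_zero]

theorem isBlockDiagonal_one : IsBlockDiagonal P (1 : Matrix (Fin n) (Fin n) ℝ) := fun i j h => by
  rw [Matrix.one_apply_ne]
  rintro rfl
  exact h (exists_part_mem_self P i)

variable {U : Submodule ℝ (EuclideanSpace ℝ (Fin n))}

/-! ### A certificate gives recovery -/

theorem BlockRealizable.recoverableByBMTFA (hU : BlockRealizable P U) :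
    RecoverableByBMTFA P U := by
  obtain ⟨Y, hY, hYU⟩ := hU
  intro B L hB hL hLU
  have hYL : Y * L = 0 := by rwa [mul_eq_zero_iff_columnSpace_le_nullSpace, hLU]
  have key : ∀ B' L', BMTFAFeasible P (B + L) B' L' → L'.trace - L.trace = (Y * L').trace := by
    intro B' L' h
    have hD : L' - L = B - B' := by
      rw [sub_eq_sub_iff_add_eq_add, add_comm L', ← h.decomp]
    rw [← Matrix.trace_sub, hD, ← (hB.sub h.blockDiagonal).trace_mul hY, ← hD, Matrix.mul_sub,
      hYL, sub_zero]
  refine ⟨⟨⟨rfl, hL, hB⟩, fun B' L' h => ?_⟩, fun B' L' h => ?_⟩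
  · have := hY.1.trace_mul_nonneg h.posSemidef
    linarith [key B' L' h]
  · have hle := h.2 B L ⟨rfl, hL, hB⟩
    have hYL' : Y * L' = 0 := by
      refine hY.1.mul_eq_zero_of_trace_mul_eq_zero h.1.posSemidef (le_antisymm ?_
        (hY.1.trace_mul_nonneg h.1.posSemidef))
      linarith [key B' L' h.1]
    have hD : L' - L = B - B' := by
      rw [sub_eq_sub_iff_add_eq_add, add_comm L', ← h.1.decomp]
    have h0 : B - B' = 0 := by
      refine (hB.sub h.1.blockDiagonal).eq_zero_of_mul_eq_zero hY ?_
      rw [← hD, Matrix.mul_sub, hYL, hYL', sub_zero]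
    rw [h0] at hD
    exact ⟨(sub_eq_zero.1 h0).symm, sub_eq_zero.1 hD⟩

/-! ### Recovery gives a certificate, by separation -/

theorem RecoverableByBMTFA.trace_nonneg (hU : RecoverableByBMTFA P U)
    {D : Matrix (Fin n) (Fin n) ℝ} (hD : IsBlockDiagonal P D)
    (hDL : (projectionMatrix U + D).PosSemidef) : 0 ≤ D.trace := by
  -- Compare the optimum `(0, projectionMatrix U)` with the competitor shifted by `D`.
  have h := (hU 0 (projectionMatrix U) (fun _ _ _ => rfl) (projectionMatrix_posSemidef U)
    (columnSpace_projectionMatrix U)).1.2 (-D) (projectionMatrix U + D) ⟨by abel, hDL, by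
      simpa using hD.smul (-1)⟩
  rw [Matrix.trace_add] at h
  linarith

theorem exists_eq_sum_mul_add (f : (Fin n → Fin n → ℝ) × ℝ →ₗ[ℝ] ℝ) :
    ∃ (C : Matrix (Fin n) (Fin n) ℝ) (c : ℝ), ∀ A r,
      f (A, r) = (∑ i, ∑ j, C i j * A i j) + c * r := by
  refine ⟨fun i j => f (Pi.single i (Pi.single j 1), 0), f (0, 1), fun A r => ?_⟩
  have hA : ((A, r) : (Fin n → Fin n → ℝ) × ℝ) =
      (∑ i, ∑ j, A i j • ((Pi.single i (Pi.single j 1), 0) : (Fin n → Fin n → ℝ) × ℝ)) +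
        r • ((0, 1) : (Fin n → Fin n → ℝ) × ℝ) := by
    ext i j
    · simp [Prod.fst_sum, Finset.sum_apply, Pi.single_apply]
    · simp [Prod.snd_sum]
  rw [hA]
  simp only [map_add, map_sum, map_smul, smul_eq_mul, mul_comm]

open Classical in
/-- The linear map sending `Y` to its diagonal blocks and its trace pairing with `L`. -/
noncomputable def blocksAndPairing (P : Finpartition (Finset.univ : Finset (Fin n)))
    (L : Matrix (Fin n) (Fin n) ℝ) :
    Matrix (Fin n) (Fin n) ℝ →ₗ[ℝ] (Fin n → Fin n → ℝ) × ℝ where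
  toFun Y := (fun i j => if ∃ I ∈ P.parts, i ∈ I ∧ j ∈ I then Y i j else 0, (Y * L).trace)
  map_add' Y Z := by
    ext i j
    · simp only [Matrix.add_apply, Prod.fst_add, Pi.add_apply]
      split_ifs <;> simp
    · simp [Matrix.add_mul]
  map_smul' c Y := by
    ext i j
    · simp only [Matrix.smul_apply, Prod.smul_fst, Pi.smul_apply, RingHom.id_apply]
      split_ifs <;> simp
    · simp

theorem trace_vecMulVec_mul (x : Fin n → ℝ) (L : Matrix (Fin n) (Fin n) ℝ) :
    (Matrix.vecMulVec x x * L).trace = x ⬝ᵥ (L *ᵥ x) := by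
  rw [Matrix.trace_mul_comm, Matrix.mul_vecMulVec, Matrix.trace_vecMulVec, dotProduct_comm]

theorem convex_spectraplex (n : ℕ) :
    Convex ℝ {Y : Matrix (Fin n) (Fin n) ℝ | Y.PosSemidef ∧ Y.trace = 1} := by
  intro Y hY Z hZ a b ha hb hab
  exact ⟨(hY.1.smul ha).add (hZ.1.smul hb), by simp [hY.2, hZ.2, hab]⟩

/-- Testing on `e_i ± e_j` bounds `|Y i j|` by the mean of two diagonal entries. -/
theorem Matrix.PosSemidef.abs_apply_le_trace {Y : Matrix (Fin n) (Fin n) ℝ}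
    (hY : Y.PosSemidef) (i j : Fin n) : |Y i j| ≤ Y.trace := by
  have hdiag : ∀ l, Y l l ≤ Y.trace := fun l =>
    Finset.single_le_sum (f := fun l => Y l l) (fun l _ => hY.diag_nonneg) (Finset.mem_univ l)
  have hsymm : Y j i = Y i j := by simpa using hY.isHermitian.apply i j
  have h1 := hY.dotProduct_mulVec_nonneg (Pi.single i 1 + Pi.single j 1)
  have h2 := hY.dotProduct_mulVec_nonneg (Pi.single i 1 - Pi.single j 1)
  simp [Matrix.mulVec_add, Matrix.mulVec_sub, add_dotProduct, sub_dotProduct, dotProduct_add,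
    dotProduct_sub, hsymm] at h1 h2
  have h3 := hdiag i
  have h4 := hdiag j
  rw [abs_le]
  constructor <;> linarith

theorem isCompact_spectraplex (n : ℕ) :
    IsCompact {Y : Matrix (Fin n) (Fin n) ℝ | Y.PosSemidef ∧ Y.trace = 1} := by
  have hK : IsCompact (Set.univ.pi fun _ => Set.univ.pi fun _ => Set.Icc (-1) 1 :
      Set (Fin n → Fin n → ℝ)) :=
    isCompact_univ_pi fun _ => isCompact_univ_pi fun _ => isCompact_Icc
  refine IsCompact.of_isClosed_subset (s := (Set.univ.pi fun _ => Set.univ.pi fun _ =>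
    Set.Icc (-1) 1 : Set (Fin n → Fin n → ℝ))) hK ?_ ?_
  · have h : {Y : Matrix (Fin n) (Fin n) ℝ | Y.PosSemidef ∧ Y.trace = 1} =
        ({Y | Yᴴ = Y} ∩ ⋂ x : Fin n → ℝ, {Y | 0 ≤ star x ⬝ᵥ (Y *ᵥ x)}) ∩ {Y | Y.trace = 1} := by
      ext Y
      simp [Matrix.posSemidef_iff_dotProduct_mulVec, Matrix.IsHermitian]
    rw [h]
    refine ((isClosed_eq (by fun_prop) (by fun_prop)).inter (isClosed_iInter fun x =>
      isClosed_le (by fun_prop) (by fun_prop))).inter (isClosed_eq (by fun_prop) (by fun_prop))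
  · intro Y hY i _ j _
    exact abs_le.1 ((hY.1.abs_apply_le_trace i j).trans_eq hY.2)

/-- Either the blocks of some positive semidefinite matrix orthogonal to `L` are the identity, or
some block-diagonal matrix certifies that this is impossible. -/
theorem exists_mem_blockElliptope_or_certificate (P : Finpartition (Finset.univ : Finset (Fin n)))
    {L : Matrix (Fin n) (Fin n) ℝ} (hL : L.PosSemidef) :
    (∃ Y ∈ blockElliptope P, (Y * L).trace = 0) ∨
      ∃ (D : Matrix (Fin n) (Fin n) ℝ) (c : ℝ), IsBlockDiagonal P D ∧ D.trace < 0 ∧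
        (D + c • L).PosSemidef := by
  classical
  rcases Nat.eq_zero_or_pos n with rfl | hn
  · exact Or.inl ⟨0, (mem_blockElliptope_iff P 0).2 ⟨Matrix.PosSemidef.zero, fun i => i.elim0⟩,
      by simp⟩
  have hn' : (0 : ℝ) < n := Nat.cast_pos.2 hn
  set A := blocksAndPairing P L with hA
  set S : Set (Matrix (Fin n) (Fin n) ℝ) := {Y | Y.PosSemidef ∧ Y.trace = 1} with hS
  -- The factor `n⁻¹` makes the target blocks compatible with trace one.
  by_cases hmem : ((fun i j => (n : ℝ)⁻¹ * (1 : Matrix (Fin n) (Fin n) ℝ) i j : Fin n → Fin n → ℝ), (0 : ℝ)) ∈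
      A '' S
  · left
    obtain ⟨Z, ⟨hZpos, -⟩, hZA⟩ := hmem
    have h1 := congrArg Prod.fst hZA
    have h2 : (Z * L).trace = 0 := congrArg Prod.snd hZA
    refine ⟨(n : ℝ) • Z, (mem_blockElliptope_iff P _).2 ⟨hZpos.smul hn'.le, fun i j hij => ?_⟩, ?_⟩
    · have h3 := congrFun (congrFun h1 i) j
      simp only [hA, blocksAndPairing, LinearMap.coe_mk, AddHom.coe_mk, if_pos hij] at h3
      rw [Matrix.smul_apply, h3, smul_eq_mul, mul_inv_cancel_left₀ hn'.ne']
    · rw [Matrix.smul_mul, Matrix.trace_smul, h2, smul_zero]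
  · right
    have hcomp : IsCompact (A '' S) :=
      (isCompact_spectraplex n).image (LinearMap.continuous_of_finiteDimensional A)
    obtain ⟨f, u, hfu, hf⟩ := geometric_hahn_banach_point_closed
      ((convex_spectraplex n).linear_image A) hcomp.isClosed hmem
    obtain ⟨C, c, hC⟩ := exists_eq_sum_mul_add f.toLinearMap
    -- Only the symmetric part of the separating functional, restricted to the blocks, matters on
    -- symmetric matrices.
    set E : Matrix (Fin n) (Fin n) ℝ :=
      Matrix.of fun i j => if ∃ I ∈ P.parts, i ∈ I ∧ j ∈ I then (C i j + C j i) / 2 else 0 with hE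
    have hEsymm : ∀ i j, E i j = E j i := by
      intro i j
      have hcomm : (∃ I ∈ P.parts, i ∈ I ∧ j ∈ I) ↔ ∃ I ∈ P.parts, j ∈ I ∧ i ∈ I := by
        simp only [and_comm]
      simp only [hE, Matrix.of_apply, hcomm, add_comm (C i j)]
    have hEblock : IsBlockDiagonal P E := fun i j h => by simp only [hE, Matrix.of_apply, if_neg h]
    have hEtrace : E.trace = ∑ i, C i i := by
      refine Finset.sum_congr rfl fun i _ => ?_
      simp only [Matrix.diag_apply, hE, Matrix.of_apply, if_pos (exists_part_mem_self P i)]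
      ring
    have hEquad : ∀ x : Fin n → ℝ, x ⬝ᵥ (E *ᵥ x) =
        ∑ i, ∑ j, C i j * if ∃ I ∈ P.parts, i ∈ I ∧ j ∈ I then x i * x j else 0 := by
      intro x
      set q : Fin n → Fin n → ℝ := fun i j =>
        C i j * if ∃ I ∈ P.parts, i ∈ I ∧ j ∈ I then x i * x j else 0 with hq
      have h1 : x ⬝ᵥ (E *ᵥ x) = ∑ i, ∑ j, (q i j + q j i) / 2 := by
        simp only [dotProduct, Matrix.mulVec, Finset.mul_sum]
        refine Finset.sum_congr rfl fun i _ => Finset.sum_congr rfl fun j _ => ?_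
        have hcomm : (∃ I ∈ P.parts, j ∈ I ∧ i ∈ I) ↔ ∃ I ∈ P.parts, i ∈ I ∧ j ∈ I := by
          simp only [and_comm]
        simp only [hq, hE, Matrix.of_apply, hcomm]
        split_ifs <;> ring
      rw [h1]
      simp only [← Finset.sum_div, Finset.sum_add_distrib]
      rw [Finset.sum_comm (f := fun i j => q j i)]
      ring
    -- Evaluate the separation on the rank-one matrices `x xᵀ`.
    have hunit : ∀ x : EuclideanSpace ℝ (Fin n), ‖x‖ = 1 →
        u < x.ofLp ⬝ᵥ (E *ᵥ x.ofLp) + c * (x.ofLp ⬝ᵥ (L *ᵥ x.ofLp)) := by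
      intro x hx
      have hxS : Matrix.vecMulVec x.ofLp x.ofLp ∈ S := by
        refine ⟨by simpa using Matrix.posSemidef_vecMulVec_self_star x.ofLp, ?_⟩
        rw [Matrix.trace_vecMulVec, ← one_pow 2, ← hx, EuclideanSpace.real_norm_sq_eq]
        simp [dotProduct, sq]
      have h := hf _ (Set.mem_image_of_mem A hxS)
      rw [hEquad, ← trace_vecMulVec_mul]
      refine h.trans_eq ?_
      exact hC _ _
    -- Subtracting `u • 1` moves the separation level to 0: the target side gives negative trace,
    -- the spectraplex side positivity.
    refine ⟨E - u • 1, c, hEblock.sub (isBlockDiagonal_one.smul u), ?_, ?_⟩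
    · have h : (n : ℝ)⁻¹ * E.trace < u := by
        refine lt_of_eq_of_lt ?_ hfu
        refine Eq.trans ?_ (hC _ _).symm
        simp [hEtrace, Matrix.one_apply, Finset.mul_sum, mul_comm]
      rw [inv_mul_lt_iff₀ hn'] at h
      simp
      linarith
    · refine Matrix.PosSemidef.of_dotProduct_mulVec_nonneg ?_ fun x => ?_
      · refine Matrix.IsHermitian.add (Matrix.IsHermitian.sub ?_ ?_) ?_
        · ext i j
          simpa using hEsymm j i
        · simp [Matrix.IsHermitian]
        · have := hL.isHermitian
          simp only [Matrix.IsHermitian, Matrix.conjTranspose_eq_transpose_of_trivial] at this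
          simp [Matrix.IsHermitian, this]
      · rcases eq_or_ne x 0 with rfl | hx
        · simp
        set y : EuclideanSpace ℝ (Fin n) := WithLp.toLp 2 x with hy
        have hynorm : 0 < ‖y‖ := norm_pos_iff.2 (by simpa [hy] using hx)
        have hyx : x ⬝ᵥ x = ‖y‖ ^ 2 := by
          rw [EuclideanSpace.real_norm_sq_eq]
          simp [hy, dotProduct, sq]
        have h := hunit (‖y‖⁻¹ • y) (by rw [norm_smul, norm_inv, norm_norm,
          inv_mul_cancel₀ hynorm.ne'])
        have e1 : (‖y‖⁻¹ • y).ofLp = ‖y‖⁻¹ • x := rfl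
        simp only [e1, Matrix.mulVec_smul, smul_dotProduct, dotProduct_smul, smul_eq_mul] at h
        have hu : u * ‖y‖ ^ 2 < x ⬝ᵥ (E *ᵥ x) + c * (x ⬝ᵥ (L *ᵥ x)) := by
          calc u * ‖y‖ ^ 2 < _ := mul_lt_mul_of_pos_right h (pow_pos hynorm 2)
            _ = _ := by field_simp
        simp only [star_trivial, Matrix.add_mulVec, Matrix.sub_mulVec, Matrix.smul_mulVec,
          Matrix.one_mulVec, dotProduct_add, dotProduct_sub, dotProduct_smul, smul_eq_mul, hyx]
        linarith

theorem RecoverableByBMTFA.blockRealizable (hU : RecoverableByBMTFA P U) :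
    BlockRealizable P U := by
  have hL := projectionMatrix_posSemidef U
  rcases exists_mem_blockElliptope_or_certificate P hL with
    ⟨Y, hY, hYL⟩ | ⟨D, c, hD, htr, hpos⟩
  · refine ⟨Y, hY, ?_⟩
    have h := hY.1.mul_eq_zero_of_trace_mul_eq_zero hL hYL
    rwa [mul_eq_zero_iff_columnSpace_le_nullSpace, columnSpace_projectionMatrix] at h
  · exfalso
    -- If `c > 0`, dividing by `c` gives a forbidden descent direction. If `c ≤ 0`, adding `-c`
    -- times the projection shows that `D` itself is positive semidefinite, against its negative
    -- trace.
    rcases lt_or_ge 0 c with hc | hc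
    · have h := hU.trace_nonneg (hD.smul c⁻¹) (by
        have h := hpos.smul (inv_nonneg.2 hc.le)
        rwa [smul_add, smul_smul, inv_mul_cancel₀ hc.ne', one_smul, add_comm] at h)
      rw [Matrix.trace_smul, smul_eq_mul] at h
      have := mul_neg_of_pos_of_neg (inv_pos.2 hc) htr
      linarith
    · have h := (hpos.add (hL.smul (neg_nonneg.2 hc))).trace_nonneg
      simp only [Matrix.trace_add, Matrix.trace_smul, smul_eq_mul] at h
      linarith

/-! ### Ellipsoid fitting -/

theorem inner_toEuclideanLin_of_mem_blockElliptope {Y : Matrix (Fin n) (Fin n) ℝ}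
    (hY : Y ∈ blockElliptope P) {I : Finset (Fin n)} (hI : I ∈ P.parts)
    {x : EuclideanSpace ℝ (Fin n)} (hx : x ∈ blockSphere I) :
    inner ℝ x (Matrix.toEuclideanLin Y x) = 1 := by
  rw [mem_blockElliptope_iff] at hY
  have h1 : x.ofLp ⬝ᵥ (Y *ᵥ x.ofLp) = x.ofLp ⬝ᵥ ((1 : Matrix (Fin n) (Fin n) ℝ) *ᵥ x.ofLp) := by
    simp only [dotProduct, Matrix.mulVec]
    refine Finset.sum_congr rfl fun i _ => ?_
    by_cases hi : i ∈ I
    · congr 1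
      refine Finset.sum_congr rfl fun j _ => ?_
      by_cases hj : j ∈ I
      · rw [hY.2 i j ⟨I, hI, hi, hj⟩]
      · rw [hx.2 j hj, mul_zero, mul_zero]
    · rw [hx.2 i hi, zero_mul, zero_mul]
  rw [inner_toEuclideanLin, h1, ← inner_toEuclideanLin, Matrix.toLpLin_one, LinearMap.id_apply,
    real_inner_self_eq_norm_sq, hx.1, one_pow]

/-- By homogeneity the form is `‖x‖ ^ 2` on each block; polarization at `e_i + e_j` then recovers
the entries. -/
theorem mem_blockElliptope_of_inner_eq_one {Y : Matrix (Fin n) (Fin n) ℝ} (hY : Y.PosSemidef)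
    (h : ∀ I ∈ P.parts, ∀ x ∈ blockSphere I, inner ℝ x (Matrix.toEuclideanLin Y x) = 1) :
    Y ∈ blockElliptope P := by
  have hquad : ∀ I ∈ P.parts, ∀ x : EuclideanSpace ℝ (Fin n), (∀ j, j ∉ I → x j = 0) →
      x.ofLp ⬝ᵥ (Y *ᵥ x.ofLp) = ‖x‖ ^ 2 := by
    intro I hI x hx
    rcases eq_or_ne x 0 with rfl | hx0
    · simp
    have hpos := norm_pos_iff.2 hx0
    have h1 := h I hI (‖x‖⁻¹ • x) ⟨by rw [norm_smul, norm_inv, norm_norm,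
      inv_mul_cancel₀ hpos.ne'], fun j hj => by simp [hx j hj]⟩
    rw [map_smul, real_inner_smul_left, real_inner_smul_right, inner_toEuclideanLin] at h1
    field_simp at h1
    exact h1
  have hsymm : ∀ i j, Y j i = Y i j := fun i j => by simpa using hY.isHermitian.apply i j
  refine (mem_blockElliptope_iff P Y).2 ⟨hY, ?_⟩
  rintro i j ⟨I, hI, hi, hj⟩
  have hdiag : ∀ i ∈ I, Y i i = 1 := fun i hi => by
    have h1 := hquad I hI (EuclideanSpace.single i 1) (fun l hl => by
      have : l ≠ i := by rintro rfl; exact hl hi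
      simp [this])
    simpa using h1
  rcases eq_or_ne i j with rfl | hij
  · rw [hdiag i hi, Matrix.one_apply_eq]
  · have h1 := hquad I hI (EuclideanSpace.single i 1 + EuclideanSpace.single j 1) (fun l hl => by
      have h1 : l ≠ i := by rintro rfl; exact hl hi
      have h2 : l ≠ j := by rintro rfl; exact hl hj
      simp [h1, h2])
    have h2 : ‖(EuclideanSpace.single i 1 + EuclideanSpace.single j 1 :
        EuclideanSpace ℝ (Fin n))‖ ^ 2 = 2 := by
      rw [norm_add_sq_real]
      simp [hij, EuclideanSpace.inner_single_left]
      norm_num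
    rw [h2] at h1
    simp [Matrix.mulVec_add, add_dotProduct, dotProduct_add, hdiag i hi, hdiag j hj,
      hsymm i j] at h1
    rw [Matrix.one_apply_ne hij]
    linarith

theorem BlockRealizable.blockEllipsoidFitting (hU : BlockRealizable P U) :
    BlockEllipsoidFitting P Uᗮ := by
  obtain ⟨Y, hY, hYU⟩ := hU
  refine ⟨n, projectionMatrix Uᗮ, rowSpace_projectionMatrix _, _, ⟨Y, hY.1, rfl⟩, ?_⟩
  rw [frontier_centeredEllipsoid]
  simp only [Set.iUnion_subset_iff, Set.image_subset_iff]
  intro I hI x hx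
  -- `Y` kills `U`, so projecting to `Uᗮ` does not change its form; `Y` itself can serve as the
  -- ellipsoid's matrix.
  have hYx : Matrix.toEuclideanLin Y (Uᗮ.starProjection x) = Matrix.toEuclideanLin Y x := by
    have h0 : Matrix.toEuclideanLin Y (U.starProjection x) = 0 :=
      hYU (Submodule.starProjection_apply_mem U x)
    conv_rhs => rw [← U.starProjection_add_starProjection_orthogonal x, map_add, h0,
      zero_add]
  have hYsymm : (Matrix.toEuclideanLin Y).IsSymmetric :=
    Matrix.isSymmetric_toEuclideanLin_iff.2 hY.1.isHermitian
  simp only [Set.mem_preimage, Set.mem_ofPred_eq, toEuclideanLin_projectionMatrix,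
    ContinuousLinearMap.coe_coe]
  rw [hYx, ← hYsymm, hYx, hYsymm]
  exact inner_toEuclideanLin_of_mem_blockElliptope hY hI hx

theorem BlockEllipsoidFitting.blockRealizable (hU : BlockEllipsoidFitting P Uᗮ) :
    BlockRealizable P U := by
  obtain ⟨k, V, hV, E, ⟨M, hM, rfl⟩, hsub⟩ := hU
  rw [frontier_centeredEllipsoid] at hsub
  simp only [Set.iUnion_subset_iff, Set.image_subset_iff] at hsub
  refine ⟨Vᵀ * M * V, mem_blockElliptope_of_inner_eq_one ?_ fun I hI x hx => ?_, ?_⟩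
  · simpa using hM.conjTranspose_mul_mul_same V
  · rw [← inner_toEuclideanLin_congruence]
    exact hsub I hI hx
  · have hVU : nullSpace V = U := by
      rw [nullSpace_eq_rowSpace_orthogonal, hV, Submodule.orthogonal_orthogonal]
    rw [← hVU]
    intro x hx
    simp only [nullSpace, LinearMap.mem_ker] at hx ⊢
    rw [Matrix.toLpLin_mul (q := 2), LinearMap.comp_apply, hx, map_zero]

end Blocks

theorem proposition5p1 {n : ℕ} (P : Finpartition (Finset.univ : Finset (Fin n)))
    (U : Submodule ℝ (EuclideanSpace ℝ (Fin n))) :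
    List.TFAE [RecoverableByBMTFA P U, BlockRealizable P U, BlockEllipsoidFitting P Uᗮ] := by
  tfae_have 1 → 2 := RecoverableByBMTFA.blockRealizable
  tfae_have 2 → 1 := BlockRealizable.recoverableByBMTFA
  tfae_have 2 → 3 := BlockRealizable.blockEllipsoidFitting
  tfae_have 3 → 2 := BlockEllipsoidFitting.blockRealizable
  tfae_finish
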